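/- Let $G$ be a simple undirected weighted graph on $n$ vertices with weight matrix $W$ (symmetric, with non-negative entries and zero diagonal) and diagonal degree matrix $D$, and let $L$ be either its combinatorial Laplacian $D-W$ or its normalized Laplacian $I-D^{-1/2}WD^{-1/2}$ (where the entry of $D^{-1/2}$ at a vertex of degree $0$ is taken to be $0$). Let $L=U\Lambda U^\top$ be an eigendecomposition with $U$ orthogonal and the diagonal entries of $\Lambda$ sorted in non-decreasing order. Let $1\le k\le n$ and $d\ge 1$ be integers, let $\Phi=U_k\in\mathbb{R}^{n\times k}$ be the matrix of the first $k$ columns of $U$, and let $H=U\begin{pmatrix} I_k&0\\0&0\end{pmatrix}U^\top$ be the ideal low-pass filter. Let $R\in\mathbb{R}^{n\times d}$ be a random matrix with independent Gaussian entries of mean $0$ and variance $1/d$, and let $\Psi=HR$. Let $\mathcal{X}$ be the set of all $n\times k$ indicator matrices, i.e. the matrices $X$ obtained from an assignment of the $n$ vertices to $k$ clusters by setting $X_{ij}=1/\sqrt{s_j}$ if vertex $i$ belongs to cluster $j$, where $s_j$ is the size of cluster $j$, and $X_{ij}=0$ otherwise. For $F\in\{\Phi,\Psi\}$ let $X_F^\ast\in\mathcal{X}$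 denote a minimizer of $X\mapsto\|F-XX^\top F\|_F$ over $\mathcal{X}$, where $\|\cdot\|_F$ is the Frobenius norm. Let $$C_\Phi=\|\Phi-X_\Phi^\ast X_\Phi^{\ast\top}\Phi\|_F$$ be the spectral clustering (SC) cost, and $$C_\Psi=\|\Phi-X_\Psi^\ast X_\Psi^{\ast\top}\Phi\|_F$$ the compressive spectral clustering (CSC) cost. Then for every $t\ge 0$, with probability at least $1-\exp(-t^2/2)$, one has for every choice of the minimizer $X_\Psi^\ast$ $$C_\Phi\le C_\Psi\le C_\Phi+2\sqrt{\frac{k}{d}}\,\bigl(\sqrt{k}+t\bigr).$$ -/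

import Mathlib

open MeasureTheory ProbabilityTheory
open scoped Matrix Matrix.Norms.Frobenius NNReal

/-- A simple undirected weighted graph on the vertices `0, …, n - 1`, given by its weight matrix:
`W i j > 0` if there is an edge between `i` and `j`, and `W i j = 0` otherwise. -/
structure WeightedGraph (n : ℕ) where
  W : Matrix (Fin n) (Fin n) ℝ
  symm : ∀ i j, W i j = W j i
  nonneg : ∀ i j, 0 ≤ W i j
  loopless : ∀ i, W i i = 0

namespace WeightedGraph

variable {n : ℕ} (G : WeightedGraph n)

/-- The (weighted) degree of a vertex. -/
def degree (i : Fin n) : ℝ := ∑ j, G.W i j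

/-- The combinatorial Laplacian `D - W`. -/
def combinatorialLaplacian : Matrix (Fin n) (Fin n) ℝ :=
  Matrix.diagonal G.degree - G.W

/-- The matrix `D^(-1/2)`; as usual, its entry at a vertex of degree `0` is `0`. -/
noncomputable def invSqrtDegree : Matrix (Fin n) (Fin n) ℝ :=
  Matrix.diagonal fun i => (Real.sqrt (G.degree i))⁻¹

/-- The normalized Laplacian `I - D^(-1/2) W D^(-1/2)`. -/
noncomputable def normalizedLaplacian : Matrix (Fin n) (Fin n) ℝ :=
  1 - G.invSqrtDegree * G.W * G.invSqrtDegree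

end WeightedGraph

/-- `L = U Λ Uᵀ` is an eigendecomposition with `U` orthogonal and with the diagonal entries `lam`
of `Λ` in non-decreasing order. -/
structure IsEigendecomposition {n : ℕ} (L U : Matrix (Fin n) (Fin n) ℝ) (lam : Fin n → ℝ) :
    Prop where
  orthogonal : U ∈ Matrix.orthogonalGroup (Fin n) ℝ
  sorted : Monotone lam
  eq : L = U * Matrix.diagonal lam * Uᵀ

/-- The matrix `U_k` of the first `k` columns of `U`: the spectral features `Φ`. -/
def spectralFeatures {n k : ℕ} (hkn : k ≤ n) (U : Matrix (Fin n) (Fin n) ℝ) :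
    Matrix (Fin n) (Fin k) ℝ :=
  U.submatrix id (Fin.castLE hkn)

/-- The ideal low-pass filter `H = U diag(1, …, 1, 0, …, 0) Uᵀ`, with `k` ones. -/
def lowPassFilter {n : ℕ} (k : ℕ) (U : Matrix (Fin n) (Fin n) ℝ) : Matrix (Fin n) (Fin n) ℝ :=
  U * Matrix.diagonal (fun i : Fin n => if (i : ℕ) < k then (1 : ℝ) else 0) * Uᵀ

/-- The indicator matrix of the assignment of the `n` data points to `k` clusters: its entry
at `(i, j)` is `1 / √s_j` if the point `i` belongs to the cluster `j`, where `s_j` is the size of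
that cluster, and `0` otherwise. -/
noncomputable def indicatorMatrix {n k : ℕ} (c : Fin n → Fin k) : Matrix (Fin n) (Fin k) ℝ :=
  Matrix.of fun i j =>
    if c i = j then 1 / Real.sqrt ((Finset.univ.filter fun l => c l = j).card : ℝ) else 0

/-- The set of all `n × k` indicator matrices. -/
def indicatorMatrices (n k : ℕ) : Set (Matrix (Fin n) (Fin k) ℝ) :=
  Set.range indicatorMatrix

/-- The `k`-means cost `‖F - X Xᵀ F‖_F` (Frobenius norm) of the assignment `X` for the feature
matrix `F`. -/
noncomputable def kMeansCost {n m k : ℕ} (F : Matrix (Fin n) (Fin m) ℝ)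
    (X : Matrix (Fin n) (Fin k) ℝ) : ℝ :=
  ‖F - X * Xᵀ * F‖

/-- `X` is an optimal `k`-means assignment for the feature matrix `F`: it minimizes the `k`-means
cost over all `n × k` indicator matrices. -/
def IsKMeansAssignment {n m k : ℕ} (F : Matrix (Fin n) (Fin m) ℝ)
    (X : Matrix (Fin n) (Fin k) ℝ) : Prop :=
  X ∈ indicatorMatrices n k ∧ ∀ Y ∈ indicatorMatrices n k, kMeansCost F X ≤ kMeansCost F Y

/-- Optimal `k`-means assignments exist. -/
theorem exists_isKMeansAssignment {n m k : ℕ} (hk : 1 ≤ k) (F : Matrix (Fin n) (Fin m) ℝ) :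
    ∃ X : Matrix (Fin n) (Fin k) ℝ, IsKMeansAssignment F X := by
  have : Nonempty (Fin k) := ⟨⟨0, hk⟩⟩
  obtain ⟨X, hX, h⟩ := Set.exists_min_image (indicatorMatrices n k) (kMeansCost F)
    (Set.finite_range _) (Set.range_nonempty _)
  exact ⟨X, hX, h⟩

/-- `R` is a random `n × d` matrix with i.i.d. centered Gaussian entries of variance `1 / d`. -/
structure IsGaussianMatrix {Ω : Type*} [MeasurableSpace Ω] (μ : Measure Ω) {n d : ℕ}
    (R : Ω → Matrix (Fin n) (Fin d) ℝ) : Prop where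
  law : ∀ i j, HasLaw (fun ω => R ω i j) (gaussianReal 0 (1 / (d : ℝ≥0))) μ
  indep : iIndepFun (fun (p : Fin n × Fin d) ω => R ω p.1 p.2) μ

/-! The lower bound is the minimality of `XΦ`. For the upper bound, `Φ` has orthonormal columns and
`H = Φ Φᵀ`, so `Ψ = Φ B` with `B = Φᵀ R`. If `V Vᵀ = 1`, then `Φ V` and `Φ` have the same cost for
every assignment. Moreover `X Xᵀ` is an orthogonal projection, so passing from `Φ V` to `Φ B`
changes any cost by at most `‖V - B‖`. Hence the excess cost is at most `2 ‖V - B‖`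
(`kMeansCost_le_add_of_isKMeansAssignment`), and `V` is chosen nearest to `B`.

The rows of `√d B` are independent standard Gaussian vectors in `ℝ^d`
(`IsGaussianMatrix.map_mul_eq`). It remains to bound the tail of their distance to the orthogonal
families of vectors of length `√d`. A Gram–Schmidt argument treats one row at a time: given `j`
orthogonal vectors, the next row costs a chi-square variable with `j` degrees of freedom plus the
squared deviation from `√d` of an independent Gaussian norm in dimension `d - j`. The exponential
moments of these two terms multiply over the rows (`lintegral_exp_distToOrthogonal_sq_le`), and
Markov's inequality gives `measure_distToOrthogonal_ge_le`. This covers `4 k < d`; otherwise the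
claimed bound is at least `‖Φ‖_F = √k`, and so trivial. -/

/-! ### Gaussian integrals in closed form. -/

theorem lintegral_pi_fin_prod {m : ℕ} (μ : Fin m → Measure ℝ) [∀ i, SigmaFinite (μ i)]
    (f : Fin m → ℝ → ENNReal) (hf : ∀ i, Measurable (f i)) :
    ∫⁻ x, ∏ i, f i (x i) ∂(Measure.pi μ) = ∏ i, ∫⁻ x, f i x ∂(μ i) := by
  induction m with
  | zero => simp
  | succ m ih =>
    rw [Fin.prod_univ_succ, ← ih _ _ fun i => hf i.succ, ← lintegral_prod_mul (hf 0).aemeasurable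
      (Measurable.aemeasurable (by
        exact Finset.measurable_prod _ fun i _ => (hf i.succ).comp (measurable_pi_apply i)))]
    have h := (measurePreserving_piFinSuccAbove μ 0).lintegral_comp_emb
      (MeasurableEquiv.measurableEmbedding _) fun z => f 0 z.1 * ∏ i, f i.succ (z.2 i)
    simpa [Fin.prod_univ_succ, MeasurableEquiv.piFinSuccAbove, Fin.insertNthEquiv,
      Fin.removeNth, Fin.tail] using h

theorem pi_gaussianReal_eq_withDensity (m : ℕ) :
    Measure.pi (fun _ : Fin m => gaussianReal 0 1) =
      (volume : Measure (Fin m → ℝ)).withDensity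
        (fun x => ∏ i, gaussianPDF 0 1 (x i)) := by
  refine Measure.pi_eq fun s hs => ?_
  rw [withDensity_apply _ (MeasurableSet.univ_pi hs),
    ← lintegral_indicator (MeasurableSet.univ_pi hs)]
  have h : ∀ x : Fin m → ℝ, (Set.univ.pi s).indicator (fun x => ∏ i, gaussianPDF 0 1 (x i)) x
      = ∏ i, (s i).indicator (gaussianPDF 0 1) (x i) := by
    intro x
    by_cases hx : x ∈ Set.univ.pi s
    · rw [Set.indicator_of_mem hx]
      exact Finset.prod_congr rfl fun i _ => (Set.indicator_of_mem (hx i trivial) _).symm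
    · rw [Set.indicator_of_notMem hx]
      obtain ⟨i, hi⟩ : ∃ i, x i ∉ s i := by simpa [Set.mem_univ_pi] using hx
      exact (Finset.prod_eq_zero (Finset.mem_univ i) (Set.indicator_of_notMem hi _)).symm
  rw [lintegral_congr h, volume_pi, lintegral_pi_fin_prod _ _ fun i =>
    (measurable_gaussianPDF 0 1).indicator (hs i)]
  refine Finset.prod_congr rfl fun i _ => ?_
  rw [lintegral_indicator (hs i), gaussianReal_apply 0 one_ne_zero]

/-- Scaling reduces to `a = 1`. That integral is `m!` times the volume of the unit ball, which is
known explicitly. -/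
theorem integral_exp_neg_mul_norm (m : ℕ) [NeZero m] {a : ℝ} (ha : 0 < a) :
    ∫ x : EuclideanSpace ℝ (Fin m), Real.exp (-(a * ‖x‖)) =
      (a ^ m)⁻¹ * (√Real.pi ^ m * (m.factorial : ℝ) / Real.Gamma ((m : ℝ) / 2 + 1)) := by
  have h1 := Measure.integral_comp_smul (volume : Measure (EuclideanSpace ℝ (Fin m)))
    (fun x => Real.exp (-‖x‖)) a
  have h2 := measure_unitBall_eq_integral_div_gamma
    (volume : Measure (EuclideanSpace ℝ (Fin m))) one_pos
  rw [EuclideanSpace.volume_ball] at h2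
  simp only [norm_smul, Real.norm_of_nonneg ha.le] at h1
  rw [h1]
  have hG : (0 : ℝ) < Real.Gamma ((m : ℝ) / 2 + 1) := Real.Gamma_pos_of_pos (by positivity)
  have h3 := congrArg ENNReal.toReal h2
  simp only [ENNReal.ofReal_one, one_pow, one_mul, Real.rpow_one, finrank_euclideanSpace,
    Fintype.card_fin, div_one] at h3
  rw [ENNReal.toReal_ofReal (by positivity), ENNReal.toReal_ofReal (by
    rw [Real.Gamma_nat_eq_factorial]
    positivity), Real.Gamma_nat_eq_factorial, eq_div_iff (by positivity)] at h3
  rw [← h3, abs_of_pos (by positivity), finrank_euclideanSpace, Fintype.card_fin, smul_eq_mul]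
  ring

/-- The integral of a non-integrable function is `0` by convention, whereas the closed form is
positive. -/
theorem integrable_exp_neg_mul_norm (m : ℕ) [NeZero m] {a : ℝ} (ha : 0 < a) :
    Integrable fun x : EuclideanSpace ℝ (Fin m) => Real.exp (-(a * ‖x‖)) := by
  by_contra h
  have h1 := integral_exp_neg_mul_norm m ha
  rw [integral_undef h] at h1
  have hG : (0 : ℝ) < Real.Gamma ((m : ℝ) / 2 + 1) := Real.Gamma_pos_of_pos (by positivity)
  have : 0 < (a ^ m)⁻¹ * (√Real.pi ^ m * (m.factorial : ℝ) / Real.Gamma ((m : ℝ) / 2 + 1)) := by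
    positivity
  exact this.ne h1

/-- With the factor `1 / 2` the quadratic part of the exponent cancels against the Gaussian density,
leaving only `exp (-a ‖x‖)` up to constants. -/
theorem lintegral_exp_norm_sub_sq (m : ℕ) [NeZero m] {a : ℝ} (ha : 0 < a) :
    ∫⁻ x : Fin m → ℝ, ENNReal.ofReal (Real.exp (1 / 2 * (√(∑ i, x i ^ 2) - a) ^ 2))
        ∂(Measure.pi fun _ : Fin m => gaussianReal 0 1) =
      ENNReal.ofReal (((√(2 * Real.pi))⁻¹ ^ m * Real.exp (a ^ 2 / 2)) * ((a ^ m)⁻¹ *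
        (√Real.pi ^ m * (m.factorial : ℝ) / Real.Gamma ((m : ℝ) / 2 + 1)))) := by
  rw [pi_gaussianReal_eq_withDensity, lintegral_withDensity_eq_lintegral_mul _
    (by
      exact Finset.measurable_prod _ fun i _ =>
        (measurable_gaussianPDF 0 1).comp (measurable_pi_apply i)) (by fun_prop)]
  have h : ∀ x : Fin m → ℝ, ((fun x : Fin m → ℝ => ∏ i, gaussianPDF 0 1 (x i)) *
      fun x : Fin m → ℝ => ENNReal.ofReal (Real.exp (1 / 2 * (√(∑ i, x i ^ 2) - a) ^ 2))) x =
      ENNReal.ofReal (((√(2 * Real.pi))⁻¹ ^ m * Real.exp (a ^ 2 / 2)) *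
        Real.exp (-(a * ‖WithLp.toLp 2 x‖))) := by
    intro x
    have hs : ‖WithLp.toLp 2 x‖ = √(∑ i, x i ^ 2) := by
      simp [EuclideanSpace.norm_eq]
    have hq : √(∑ i, x i ^ 2) ^ 2 = ∑ i, x i ^ 2 :=
      Real.sq_sqrt (Finset.sum_nonneg fun i _ => sq_nonneg _)
    simp only [Pi.mul_apply, gaussianPDF]
    rw [← ENNReal.ofReal_prod_of_nonneg fun i _ => gaussianPDFReal_nonneg _ _ _,
      ← ENNReal.ofReal_mul (Finset.prod_nonneg fun i _ => gaussianPDFReal_nonneg _ _ _), hs]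
    congr 1
    simp only [gaussianPDFReal, NNReal.coe_one, mul_one, sub_zero]
    rw [Finset.prod_mul_distrib, Finset.prod_const, Finset.card_univ, Fintype.card_fin,
      ← Real.exp_sum, mul_assoc, mul_assoc, ← Real.exp_add, ← Real.exp_add, ← Finset.sum_div,
      Finset.sum_neg_distrib]
    congr 2
    linear_combination (1 / 2) * hq
  rw [lintegral_congr h, (PiLp.volume_preserving_toLp (Fin m)).lintegral_comp (f := fun x =>
    ENNReal.ofReal (((√(2 * Real.pi))⁻¹ ^ m * Real.exp (a ^ 2 / 2)) * Real.exp (-(a * ‖x‖))))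
    (by fun_prop), ← ofReal_integral_eq_lintegral_ofReal
    ((integrable_exp_neg_mul_norm m ha).const_mul _) (Filter.Eventually.of_forall fun x => by
      positivity), integral_const_mul, integral_exp_neg_mul_norm m ha]

theorem lintegral_exp_sq_div_four :
    ∫⁻ x, ENNReal.ofReal (Real.exp (1 / 4 * x ^ 2)) ∂(gaussianReal 0 1) = ENNReal.ofReal √2 := by
  rw [gaussianReal_of_var_ne_zero 0 one_ne_zero, lintegral_withDensity_eq_lintegral_mul _
    (measurable_gaussianPDF 0 1) (by fun_prop)]
  have h : ∀ x : ℝ, (gaussianPDF 0 1 * fun x : ℝ => ENNReal.ofReal (Real.exp (1 / 4 * x ^ 2))) x =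
      ENNReal.ofReal ((√(2 * Real.pi))⁻¹ * Real.exp (-(1 / 4) * x ^ 2)) := by
    intro x
    simp only [Pi.mul_apply, gaussianPDF]
    rw [← ENNReal.ofReal_mul (gaussianPDFReal_nonneg _ _ _)]
    simp only [gaussianPDFReal, NNReal.coe_one, mul_one, sub_zero]
    rw [mul_assoc, ← Real.exp_add]
    congr 3
    ring
  rw [lintegral_congr h, ← ofReal_integral_eq_lintegral_ofReal
    ((integrable_exp_neg_mul_sq (by norm_num)).const_mul _) (Filter.Eventually.of_forall fun x => by
      positivity), integral_const_mul, integral_gaussian]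
  congr 1
  rw [← Real.sqrt_inv, ← Real.sqrt_mul (by positivity)]
  congr 1
  field_simp
  norm_num

/-! ### Stirling-type bounds for factorials and the Gamma function. -/

theorem factorial_eq_stirlingSeq {n : ℕ} (hn : n ≠ 0) :
    (n.factorial : ℝ) = Stirling.stirlingSeq n * (√(2 * n) * (n / Real.exp 1) ^ n) := by
  have : (0 : ℝ) < n := by positivity
  rw [Stirling.stirlingSeq, div_mul_cancel₀]
  positivity

theorem stirlingSeq_le_of_le {i j : ℕ} (hi : i ≠ 0) (hij : i ≤ j) :
    Stirling.stirlingSeq j ≤ Stirling.stirlingSeq i := by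
  obtain ⟨i, rfl⟩ := Nat.exists_eq_succ_of_ne_zero hi
  obtain ⟨j, rfl⟩ := Nat.exists_eq_succ_of_ne_zero (by omega : j ≠ 0)
  exact Stirling.stirlingSeq'_antitone (by omega : i ≤ j)

theorem sq_factorial_two_mul_div_factorial_le {j : ℕ} (hj : j ≠ 0) :
    (((2 * j).factorial : ℝ) / j.factorial) ^ 2 ≤ 2 * (4 * j / Real.exp 1) ^ (2 * j) := by
  have hj' : (0 : ℝ) < j := by positivity
  have h1 := factorial_eq_stirlingSeq (n := 2 * j) (by omega)
  have h2 := factorial_eq_stirlingSeq hj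
  have h3 := stirlingSeq_le_of_le hj (by omega : j ≤ 2 * j)
  have h4 : ((2 * j).factorial : ℝ) / j.factorial ≤ √2 * (4 * j / Real.exp 1) ^ j := by
    rw [div_le_iff₀ (by positivity), h1, h2]
    calc _ ≤ Stirling.stirlingSeq j *
          (√(2 * (2 * j : ℕ)) * (((2 * j : ℕ) : ℝ) / Real.exp 1) ^ (2 * j)) := by gcongr
      _ = _ := by
        push_cast
        rw [Real.sqrt_mul (by norm_num) (2 * (j : ℝ)), pow_mul]
        have : (2 * (j : ℝ) / Real.exp 1) ^ 2 = (4 * j / Real.exp 1) * (j / Real.exp 1) := by ring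
        rw [this, mul_pow]
        ring
  calc _ ≤ (√2 * (4 * j / Real.exp 1) ^ j) ^ 2 := by gcongr
    _ = _ := by rw [mul_pow, Real.sq_sqrt (by norm_num), ← pow_mul, mul_comm j 2]

/-- For `j ≥ 1` the Stirling sequence is at most its first value `e / √2`; the remaining room comes
from `j ^ (2j+1) e ≤ (j + 1/2) ^ (2j+1)` and `e ≤ π`. -/
theorem sq_factorial_le (j : ℕ) :
    (j.factorial : ℝ) ^ 2 ≤
      Real.pi * Real.exp 1 * ((2 * j + 1) / (2 * Real.exp 1)) ^ (2 * j + 1) := by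
  have hpi := Real.pi_gt_three
  have he := Real.exp_one_lt_d9
  rcases eq_or_ne j 0 with rfl | hj
  · simp
    field_simp
    linarith
  have hj' : (0 : ℝ) < j := by positivity
  have h2 := factorial_eq_stirlingSeq hj
  have h3 := stirlingSeq_le_of_le one_ne_zero (by omega : 1 ≤ j)
  rw [Stirling.stirlingSeq_one] at h3
  have h4 : (j.factorial : ℝ) ≤ Real.exp 1 / √2 * (√(2 * j) * (j / Real.exp 1) ^ j) := by
    rw [h2]; gcongr
  have h5 : (j : ℝ) ^ (2 * j + 1) * Real.exp 1 ≤ ((2 * j + 1) / 2) ^ (2 * j + 1) := by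
    -- This is `1 - x ≤ exp (-x)` at `x = 1 / (2j+1)`; its power `2j+1` produces the factor `e`.
    have h6 : (j : ℝ) * Real.exp (1 / (2 * j + 1)) ≤ (2 * j + 1) / 2 := by
      have := Real.add_one_le_exp (-(1 / (2 * j + 1) : ℝ))
      rw [Real.exp_neg, le_inv_comm₀ (by
        rw [neg_add_eq_sub, sub_pos, div_lt_one] <;> linarith) (Real.exp_pos _)] at this
      calc _ ≤ (j : ℝ) * (-(1 / (2 * (j : ℝ) + 1)) + 1)⁻¹ := by gcongr
        _ = _ := by
          have : -(1 / (2 * (j : ℝ) + 1)) + 1 = 2 * j / (2 * j + 1) := by field_simp; ring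
          rw [this]
          field_simp
    calc _ = ((j : ℝ) * Real.exp (1 / (2 * j + 1))) ^ (2 * j + 1) := by
          rw [mul_pow, ← Real.exp_nat_mul]
          congr 2
          push_cast
          field_simp
      _ ≤ _ := by gcongr
  calc (j.factorial : ℝ) ^ 2 ≤ (Real.exp 1 / √2 * (√(2 * j) * (j / Real.exp 1) ^ j)) ^ 2 := by
        gcongr
    _ = Real.exp 1 * Real.exp 1 * ((j : ℝ) ^ (2 * j + 1) * Real.exp 1) /
          Real.exp 1 ^ (2 * j + 1) := by
        rw [mul_pow, mul_pow, div_pow, Real.sq_sqrt (by norm_num), Real.sq_sqrt (by positivity)]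
        rw [← pow_mul, mul_comm j 2, div_pow, pow_succ (j : ℝ), pow_succ (Real.exp 1) (2 * j)]
        field_simp
    _ ≤ Real.pi * Real.exp 1 * ((2 * j + 1) / 2) ^ (2 * j + 1) / Real.exp 1 ^ (2 * j + 1) := by
        gcongr
        linarith
    _ = _ := by
        rw [mul_div_assoc, ← div_pow, div_div]

/-- For even `m` the Gamma value is a factorial, and `2 ≤ e` finishes. For odd `m = 2j + 1`,
Legendre's duplication formula turns the quotient into `2 ^ m j! / √π`. -/
theorem sq_factorial_div_Gamma_le {m : ℕ} (hm : m ≠ 0) :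
    ((m.factorial : ℝ) / Real.Gamma ((m : ℝ) / 2 + 1)) ^ 2 ≤
      Real.exp 1 * (2 * m / Real.exp 1) ^ m := by
  have he := Real.exp_one_gt_d9
  obtain ⟨j, rfl | rfl⟩ := Nat.even_or_odd' m
  · have : ((2 * j : ℕ) : ℝ) / 2 + 1 = j + 1 := by push_cast; ring
    rw [this, Real.Gamma_nat_eq_factorial]
    refine (sq_factorial_two_mul_div_factorial_le (by omega)).trans ?_
    push_cast
    rw [← mul_assoc 2 2 (j : ℝ)]
    norm_num
    gcongr
    linarith
  · have h1 := Real.Gamma_mul_Gamma_add_half ((j : ℝ) + 1)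
    have h2 : (j : ℝ) + 1 + 1 / 2 = ((2 * j + 1 : ℕ) : ℝ) / 2 + 1 := by push_cast; ring
    have h3 : 2 * ((j : ℝ) + 1) = ((2 * j + 1 : ℕ) : ℝ) + 1 := by push_cast; ring
    have h4 : 1 - (((2 * j + 1 : ℕ) : ℝ) + 1) = -((2 * j + 1 : ℕ) : ℝ) := by ring
    rw [h2, h3, h4, Real.Gamma_nat_eq_factorial, Real.Gamma_nat_eq_factorial, Real.rpow_neg (by
      norm_num), Real.rpow_natCast] at h1
    have hG : 0 < Real.Gamma (((2 * j + 1 : ℕ) : ℝ) / 2 + 1) :=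
      Real.Gamma_pos_of_pos (by positivity)
    have h5 : ((2 * j + 1).factorial : ℝ) / Real.Gamma (((2 * j + 1 : ℕ) : ℝ) / 2 + 1) =
        2 ^ (2 * j + 1) * j.factorial / √Real.pi := by
      rw [div_eq_div_iff hG.ne' (by positivity)]
      rw [mul_assoc _ _ (Real.Gamma _), h1]
      field_simp
    rw [h5, div_pow, mul_pow, Real.sq_sqrt Real.pi_pos.le, div_le_iff₀ Real.pi_pos]
    calc _ ≤ ((2 : ℝ) ^ (2 * j + 1)) ^ 2 * (Real.pi * Real.exp 1 *
          ((2 * j + 1) / (2 * Real.exp 1)) ^ (2 * j + 1)) := by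
          gcongr; exact sq_factorial_le j
      _ = Real.exp 1 * (2 ^ 2 * ((2 * j + 1) / (2 * Real.exp 1))) ^ (2 * j + 1) * Real.pi := by
          rw [mul_pow (2 ^ 2 : ℝ), ← pow_mul, ← pow_mul, mul_comm 2 (2 * j + 1)]
          ring
      _ = _ := by
          congr 3
          push_cast
          field_simp

/-! ### Exponential moments of the deviation of a Gaussian norm from `a`. -/

/-- After squaring, the closed form is at most `e ^ (a² + 1 - m) (m / a²) ^ m`. Then `x ≤ e ^ (x -
1)` at `x = m / a²` completes the square in the exponent. -/
theorem lintegral_exp_norm_sub_sq_le {m : ℕ} (hm : m ≠ 0) {a : ℝ} (ha : 0 < a) :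
    ∫⁻ x : Fin m → ℝ, ENNReal.ofReal (Real.exp (1 / 2 * (√(∑ i, x i ^ 2) - a) ^ 2))
        ∂(Measure.pi fun _ : Fin m => gaussianReal 0 1) ≤
      ENNReal.ofReal (Real.exp ((1 + (a ^ 2 - m) ^ 2 / a ^ 2) / 2)) := by
  have : NeZero m := ⟨hm⟩
  have hm' : (0 : ℝ) < m := by positivity
  rw [lintegral_exp_norm_sub_sq m ha]
  refine ENNReal.ofReal_le_ofReal (abs_le_of_sq_le_sq' ?_ (Real.exp_pos _).le).2
  have h1 := sq_factorial_div_Gamma_le hm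
  set q := (m.factorial : ℝ) / Real.Gamma ((m : ℝ) / 2 + 1) with hq
  have h2 : ((m : ℝ) / a ^ 2) ^ m ≤ Real.exp (m * (m / a ^ 2 - 1)) := by
    rw [Real.exp_nat_mul]
    gcongr
    linarith [Real.add_one_le_exp ((m : ℝ) / a ^ 2 - 1)]
  calc _ = (2 * Real.pi)⁻¹ ^ m * Real.exp (a ^ 2) * ((a ^ 2) ^ m)⁻¹ * Real.pi ^ m * q ^ 2 := by
        rw [mul_div_assoc, ← hq]
        simp only [mul_pow]
        rw [← pow_mul, mul_comm m 2, pow_mul, inv_pow √_, Real.sq_sqrt (by positivity),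
          ← Real.exp_nat_mul, inv_pow (a ^ m), ← pow_mul a, mul_comm m 2, pow_mul a, ← pow_mul √_, mul_comm m 2,
          pow_mul √_, Real.sq_sqrt (by positivity)]
        push_cast
        rw [mul_div_cancel₀ _ (two_ne_zero)]
        ring
    _ ≤ (2 * Real.pi)⁻¹ ^ m * Real.exp (a ^ 2) * ((a ^ 2) ^ m)⁻¹ * Real.pi ^ m *
          (Real.exp 1 * (2 * m / Real.exp 1) ^ m) := by gcongr
    _ = Real.exp (a ^ 2) * Real.exp 1 * Real.exp (-m) * ((m : ℝ) / a ^ 2) ^ m := by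
        have : Real.exp (-m) = (Real.exp 1)⁻¹ ^ m := by
          rw [← Real.exp_neg, ← Real.exp_nat_mul]
          ring_nf
        rw [this]
        simp only [mul_pow, div_pow, inv_pow, mul_inv]
        field_simp
    _ ≤ Real.exp (a ^ 2) * Real.exp 1 * Real.exp (-m) * Real.exp (m * (m / a ^ 2 - 1)) := by
        gcongr
    _ = _ := by
        rw [← Real.exp_nat_mul, ← Real.exp_add, ← Real.exp_add, ← Real.exp_add]
        congr 1
        field_simp
        push_cast
        ring

/-- Halving the exponent halves the logarithm of the bound. In place of Jensen's inequality, `z ≤ (e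
^ (-b) z² + e ^ b) / 2` is integrated, with `b` half the earlier exponent. -/
theorem lintegral_exp_norm_sub_sq_div_four_le {m : ℕ} (hm : m ≠ 0) {a : ℝ} (ha : 0 < a) :
    ∫⁻ x : Fin m → ℝ, ENNReal.ofReal (Real.exp (1 / 4 * (√(∑ i, x i ^ 2) - a) ^ 2))
        ∂(Measure.pi fun _ : Fin m => gaussianReal 0 1) ≤
      ENNReal.ofReal (Real.exp ((1 + (a ^ 2 - m) ^ 2 / a ^ 2) / 4)) := by
  set b := (1 + (a ^ 2 - m) ^ 2 / a ^ 2) / 4 with hb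
  have h1 := lintegral_exp_norm_sub_sq_le hm ha
  have h2 : ∀ x : Fin m → ℝ, ENNReal.ofReal (Real.exp (1 / 4 * (√(∑ i, x i ^ 2) - a) ^ 2)) ≤
      ENNReal.ofReal (Real.exp (-b) / 2) *
        ENNReal.ofReal (Real.exp (1 / 2 * (√(∑ i, x i ^ 2) - a) ^ 2)) +
      ENNReal.ofReal (Real.exp b / 2) := by
    intro x
    rw [← ENNReal.ofReal_mul (by positivity), ← ENNReal.ofReal_add (by positivity) (by positivity)]
    apply ENNReal.ofReal_le_ofReal
    set y := (√(∑ i, x i ^ 2) - a) ^ 2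
    have e1 : Real.exp (1 / 2 * y) = Real.exp (1 / 4 * y) ^ 2 := by
      rw [← Real.exp_nat_mul]; push_cast; ring_nf
    rw [e1, Real.exp_neg, ← sub_nonneg]
    have : (Real.exp b)⁻¹ / 2 * Real.exp (1 / 4 * y) ^ 2 + Real.exp b / 2 - Real.exp (1 / 4 * y) =
        (Real.exp b)⁻¹ / 2 * (Real.exp (1 / 4 * y) - Real.exp b) ^ 2 := by
      field_simp
      ring
    rw [this]
    positivity
  refine (lintegral_mono h2).trans ?_
  rw [lintegral_add_right _ measurable_const, lintegral_const_mul _ (by fun_prop), lintegral_const,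
    measure_univ, mul_one]
  refine (add_le_add_left (mul_le_mul_right h1 _) _).trans ?_
  rw [← ENNReal.ofReal_mul (by positivity), ← ENNReal.ofReal_add (by positivity) (by positivity)]
  apply ENNReal.ofReal_le_ofReal
  have : Real.exp ((1 + (a ^ 2 - m) ^ 2 / a ^ 2) / 2) = Real.exp b * Real.exp b := by
    rw [← Real.exp_add, hb]; ring_nf
  rw [this, Real.exp_neg]
  field_simp
  norm_num

/-! ### Distance of Gaussian vectors to scaled orthonormal families. -/

/-- The families of pairwise orthogonal vectors of length `a`. -/
def scaledOrthonormalFamilies (E : Type*) [NormedAddCommGroup E] [InnerProductSpace ℝ E] (a : ℝ)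
    (k : ℕ) : Set (PiLp 2 fun _ : Fin k => E) :=
  {Z | ∀ i l, inner ℝ (Z i) (Z l) = if i = l then a ^ 2 else 0}

theorem exists_norm_eq_and_norm_sub_smul_sq {m : ℕ} (hm : m ≠ 0) (w : EuclideanSpace ℝ (Fin m))
    (a : ℝ) :
    ∃ u : EuclideanSpace ℝ (Fin m), ‖u‖ = 1 ∧ ‖w - a • u‖ ^ 2 = (‖w‖ - a) ^ 2 := by
  obtain ⟨u, hu, hw⟩ : ∃ u : EuclideanSpace ℝ (Fin m), ‖u‖ = 1 ∧ w = ‖w‖ • u := by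
    by_cases hw : w = 0
    · exact ⟨EuclideanSpace.single ⟨0, by omega⟩ 1, by simp, by simp [hw]⟩
    · refine ⟨‖w‖⁻¹ • w, norm_smul_inv_norm hw, ?_⟩
      rw [smul_smul, mul_inv_cancel₀ (norm_ne_zero_iff.2 hw), one_smul]
  refine ⟨u, hu, ?_⟩
  nth_rewrite 1 [hw]
  rw [← sub_smul, norm_smul, hu, mul_one, Real.norm_eq_abs, sq_abs]

/-- A standard Gaussian vector `y` is close to a vector of length `a` that is orthogonal to `j`
given orthogonal vectors: the squared distance is at most the squared length of the projection of
`y` onto their span plus the squared deviation from `a` of the length of the complementary part. -/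
theorem exists_orthogonal_near_stdGaussian {E : Type*} [NormedAddCommGroup E]
    [InnerProductSpace ℝ E] [FiniteDimensional ℝ E] [MeasurableSpace E] [BorelSpace E]
    {a : ℝ} (ha : 0 < a) (l : ℝ) {j m : ℕ} (hm : m ≠ 0) (hd : Module.finrank ℝ E = j + m)
    {Z : PiLp 2 fun _ : Fin j => E} (hZ : Z ∈ scaledOrthonormalFamilies E a j) :
    ∃ g : E → ℝ, (∀ y, ∃ z, ‖z‖ = a ∧ (∀ i, inner ℝ (Z i) z = 0) ∧ ‖y - z‖ ^ 2 ≤ g y) ∧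
      ∫⁻ y, ENNReal.ofReal (Real.exp (l * g y)) ∂(stdGaussian E) =
        (∫⁻ x, ENNReal.ofReal (Real.exp (l * x ^ 2)) ∂(gaussianReal 0 1)) ^ j *
        ∫⁻ x : Fin m → ℝ, ENNReal.ofReal (Real.exp (l * (√(∑ i, x i ^ 2) - a) ^ 2))
          ∂(Measure.pi fun _ : Fin m => gaussianReal 0 1) := by
  classical
  -- The zeros are placeholders: only the left summand must be orthonormal to extend to a basis `b`.
  let v : Fin j ⊕ Fin m → E := Sum.elim (fun i => a⁻¹ • Z i) fun _ => 0
  have hv : Orthonormal ℝ ((Set.range Sum.inl).domRestrict v) := by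
    rw [orthonormal_iff_ite]
    rintro ⟨_, i, rfl⟩ ⟨_, i', rfl⟩
    have := hZ i i'
    simp only [v, Set.domRestrict_apply, Sum.elim_inl, real_inner_smul_left, real_inner_smul_right,
      this]
    by_cases hi : i = i'
    · subst hi
      simp only [if_true]
      field_simp
    · rw [if_neg hi, if_neg fun h => hi (Sum.inl_injective (Subtype.ext_iff.1 h))]
      simp
  obtain ⟨b, hb⟩ := hv.exists_orthonormalBasis_extension_of_card_eq (by simpa using hd)
  have hbZ : ∀ i, Z i = a • b (Sum.inl i) := fun i => by
    rw [hb _ ⟨i, rfl⟩]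
    simp [v, smul_smul, ha.ne']
  let G : E → ℝ := fun y => ∑ i, b.repr y (Sum.inl i) ^ 2 +
    (√(∑ i, b.repr y (Sum.inr i) ^ 2) - a) ^ 2
  refine ⟨G, fun y => ?_, ?_⟩
  · obtain ⟨u, hu, hw⟩ := exists_norm_eq_and_norm_sub_smul_sq hm
      (WithLp.toLp 2 fun i => b.repr y (Sum.inr i)) a
    -- Coordinates of the near vector: the span of `Z` is removed, and the complementary part is
    -- replaced by its nearest vector of length `a`.
    let c : EuclideanSpace ℝ (Fin j ⊕ Fin m) :=
      WithLp.toLp 2 (Sum.elim (fun _ => 0) fun i => a * u i)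
    have hu' : ∑ i, u i ^ 2 = 1 := by
      rw [← EuclideanSpace.real_norm_sq_eq, hu, one_pow]
    refine ⟨b.repr.symm c, ?_, fun i => ?_, ?_⟩
    · rw [LinearIsometryEquiv.norm_map, ← sq_eq_sq₀ (norm_nonneg _) ha.le,
        EuclideanSpace.real_norm_sq_eq]
      simp [c, mul_pow, ← Finset.mul_sum, hu']
    · rw [hbZ, real_inner_smul_left, ← b.repr_apply_apply]
      simp [c]
    · rw [← b.repr.norm_map, map_sub, LinearIsometryEquiv.apply_symm_apply,
        EuclideanSpace.real_norm_sq_eq]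
      rw [EuclideanSpace.real_norm_sq_eq, EuclideanSpace.norm_eq] at hw
      simp only [Real.norm_eq_abs, sq_abs] at hw
      simp only [G, ← hw]
      simp [c]
  · rw [stdGaussian_eq_map_pi_orthonormalBasis b, lintegral_map (by fun_prop) (by fun_prop)]
    have hG : ∀ x : Fin j ⊕ Fin m → ℝ, G (∑ i, x i • b i) =
        ∑ i, x (Sum.inl i) ^ 2 + (√(∑ i, x (Sum.inr i) ^ 2) - a) ^ 2 := by
      intro x
      have : ∀ i, b.repr (∑ i, x i • b i) i = x i := fun i => by
        rw [b.repr_apply_apply, b.orthonormal.inner_right_fintype]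
      simp only [G, this]
    simp only [hG]
    have h := (measurePreserving_sumPiEquivProdPi fun _ : Fin j ⊕ Fin m =>
      gaussianReal 0 1).lintegral_comp_emb (MeasurableEquiv.measurableEmbedding _)
      fun z : (Fin j → ℝ) × (Fin m → ℝ) => (∏ i, ENNReal.ofReal (Real.exp (l * z.1 i ^ 2))) *
        ENNReal.ofReal (Real.exp (l * (√(∑ i, z.2 i ^ 2) - a) ^ 2))
    have h' := lintegral_prod_mul (μ := Measure.pi fun _ : Fin j => gaussianReal 0 1)
      (ν := Measure.pi fun _ : Fin m => gaussianReal 0 1)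
      (f := fun x : Fin j → ℝ => ∏ i, ENNReal.ofReal (Real.exp (l * x i ^ 2)))
      (g := fun x : Fin m → ℝ => ENNReal.ofReal (Real.exp (l * (√(∑ i, x i ^ 2) - a) ^ 2)))
      (Measurable.aemeasurable (by fun_prop)) (Measurable.aemeasurable (by fun_prop))
    rw [lintegral_pi_fin_prod _ (fun _ x => ENNReal.ofReal (Real.exp (l * x ^ 2)))
      (by fun_prop), Finset.prod_const, Finset.card_univ, Fintype.card_fin] at h'
    rw [← h', ← h]
    refine lintegral_congr fun x => ?_
    rw [mul_add, Real.exp_add, ENNReal.ofReal_mul (by positivity), Finset.mul_sum, Real.exp_sum,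
      ENNReal.ofReal_prod_of_nonneg fun _ _ => (Real.exp_pos _).le]
    rfl

section ScaledOrthonormalFamilies

variable {E : Type*} [NormedAddCommGroup E] [InnerProductSpace ℝ E] {a : ℝ} {k : ℕ}

theorem norm_eq_of_mem_scaledOrthonormalFamilies (ha : 0 ≤ a) {Z : PiLp 2 fun _ : Fin k => E}
    (hZ : Z ∈ scaledOrthonormalFamilies E a k) (i : Fin k) : ‖Z i‖ = a := by
  rw [← sq_eq_sq₀ (norm_nonneg _) ha, ← real_inner_self_eq_norm_sq, hZ, if_pos rfl]

theorem isCompact_scaledOrthonormalFamilies [FiniteDimensional ℝ E] (ha : 0 ≤ a) :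
    IsCompact (scaledOrthonormalFamilies E a k) := by
  refine Metric.isCompact_of_isClosed_isBounded ?_ ?_
  · simp only [scaledOrthonormalFamilies, Set.ofPred_forall]
    refine isClosed_iInter fun i => isClosed_iInter fun l => ?_
    exact isClosed_eq (by fun_prop) continuous_const
  · refine isBounded_iff_forall_norm_le.2 ⟨√(k * a ^ 2), fun Z hZ => ?_⟩
    rw [PiLp.norm_eq_of_L2]
    simp [norm_eq_of_mem_scaledOrthonormalFamilies ha hZ]

theorem scaledOrthonormalFamilies_nonempty [FiniteDimensional ℝ E]
    (hk : k ≤ Module.finrank ℝ E) : (scaledOrthonormalFamilies E a k).Nonempty := by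
  refine ⟨WithLp.toLp 2 fun i => a • stdOrthonormalBasis ℝ E (Fin.castLE hk i), fun i l => ?_⟩
  simp only [real_inner_smul_left, real_inner_smul_right,
    orthonormal_iff_ite.1 (stdOrthonormalBasis ℝ E).orthonormal, (Fin.castLE_injective hk).eq_iff]
  split_ifs
  · ring
  · simp

theorem snoc_mem_scaledOrthonormalFamilies {Z : PiLp 2 fun _ : Fin k => E}
    (hZ : Z ∈ scaledOrthonormalFamilies E a k) {z : E} (hz : ‖z‖ = a)
    (h : ∀ i, inner ℝ (Z i) z = 0) :
    WithLp.toLp 2 (Fin.snoc (α := fun _ => E) (fun i => Z i) z) ∈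
      scaledOrthonormalFamilies E a (k + 1) := by
  intro i l
  refine Fin.lastCases ?_ (fun i => ?_) i <;> refine Fin.lastCases ?_ (fun l => ?_) l
  · simp [hz]
  · simpa [real_inner_comm, (Fin.castSucc_lt_last l).ne'] using h l
  · simpa [(Fin.castSucc_lt_last i).ne] using h i
  · simpa using hZ i l

/-- The distance of a family of `k` vectors to the orthogonal families of vectors of length `a`. -/
noncomputable def distToOrthogonal (a : ℝ) (Y : Fin k → E) : ℝ :=
  Metric.infDist (WithLp.toLp 2 Y) (scaledOrthonormalFamilies E a k)

theorem distToOrthogonal_nonneg (Y : Fin k → E) : 0 ≤ distToOrthogonal a Y :=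
  Metric.infDist_nonneg

theorem continuous_distToOrthogonal : Continuous (distToOrthogonal (E := E) (k := k) a) :=
  (Metric.continuous_infDist_pt _).comp (PiLp.continuous_toLp 2 _)

theorem exists_distToOrthogonal_sq_eq [FiniteDimensional ℝ E] (ha : 0 ≤ a)
    (hk : k ≤ Module.finrank ℝ E) (Y : Fin k → E) :
    ∃ Z ∈ scaledOrthonormalFamilies E a k,
      distToOrthogonal a Y ^ 2 = ∑ i, ‖Y i - Z i‖ ^ 2 := by
  obtain ⟨Z, hZ, h⟩ := (isCompact_scaledOrthonormalFamilies ha).exists_infDist_eq_dist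
    (scaledOrthonormalFamilies_nonempty (a := a) hk) (WithLp.toLp 2 Y)
  refine ⟨Z, hZ, ?_⟩
  rw [distToOrthogonal, h, dist_eq_norm, PiLp.norm_sq_eq_of_L2]
  rfl

theorem distToOrthogonal_sq_le {Z : PiLp 2 fun _ : Fin k => E}
    (hZ : Z ∈ scaledOrthonormalFamilies E a k) (Y : Fin k → E) :
    distToOrthogonal a Y ^ 2 ≤ ∑ i, ‖Y i - Z i‖ ^ 2 := by
  calc distToOrthogonal a Y ^ 2 ≤ dist (WithLp.toLp 2 Y) Z ^ 2 := by
        gcongr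
        · exact distToOrthogonal_nonneg Y
        · exact Metric.infDist_le_dist_of_mem hZ
    _ = _ := by
        rw [dist_eq_norm, PiLp.norm_sq_eq_of_L2]
        rfl

end ScaledOrthonormalFamilies

/-- Exponential moments of the squared distance of `k` independent standard Gaussian vectors to the
orthogonal families of vectors of length `a`, row by row. -/
theorem lintegral_exp_distToOrthogonal_sq_le {E : Type*} [NormedAddCommGroup E]
    [InnerProductSpace ℝ E] [FiniteDimensional ℝ E] [MeasurableSpace E] [BorelSpace E]
    {a : ℝ} (ha : 0 < a) {l : ℝ} (hl : 0 ≤ l) (M : ℕ → ENNReal) {k : ℕ}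
    (hk : k ≤ Module.finrank ℝ E)
    (hM : ∀ j < k, (∫⁻ x, ENNReal.ofReal (Real.exp (l * x ^ 2)) ∂(gaussianReal 0 1)) ^ j *
        ∫⁻ x : Fin (Module.finrank ℝ E - j) → ℝ,
          ENNReal.ofReal (Real.exp (l * (√(∑ i, x i ^ 2) - a) ^ 2))
          ∂(Measure.pi fun _ => gaussianReal 0 1) ≤ M j) :
    ∫⁻ Y : Fin k → E, ENNReal.ofReal (Real.exp (l * distToOrthogonal a Y ^ 2))
        ∂(Measure.pi fun _ => stdGaussian E) ≤ ∏ j ∈ Finset.range k, M j := by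
  induction k with
  | zero =>
    have : ∀ Y : Fin 0 → E, distToOrthogonal a Y ^ 2 = 0 := fun Y =>
      le_antisymm ((distToOrthogonal_sq_le (Z := 0) (fun i => i.elim0) Y).trans (by simp))
        (sq_nonneg _)
    simp [this]
  | succ k ih =>
    have hm : ∀ k, Measurable fun Y : Fin k → E =>
        ENNReal.ofReal (Real.exp (l * distToOrthogonal a Y ^ 2)) := fun k => by
      have := (continuous_distToOrthogonal (E := E) (k := k) (a := a)).measurable
      fun_prop
    have h := (measurePreserving_piFinSuccAbove (fun _ : Fin (k + 1) => stdGaussian E)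
      (Fin.last k)).symm.lintegral_comp (hm (k + 1))
    rw [← h, Finset.prod_range_succ]
    refine (lintegral_prod_symm' _ ((hm _).comp (MeasurableEquiv.measurable _))).le.trans ?_
    refine le_trans ?_ (mul_le_mul_left (ih (by omega) fun j hj => hM j (by omega)) (M k))
    rw [← lintegral_mul_const _ (hm k)]
    refine lintegral_mono fun Y => ?_
    -- `Z` depends on `Y`, but the integral over the last row is bounded independently of `Z`, so no
    -- measurable selection is needed.
    obtain ⟨Z, hZ, hYZ⟩ := exists_distToOrthogonal_sq_eq ha.le (by omega) Y
    obtain ⟨g, hg, hgM⟩ := exists_orthogonal_near_stdGaussian ha l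
      (m := Module.finrank ℝ E - k) (by omega) (by omega) hZ
    refine le_trans ?_ (mul_le_mul_right (hgM.le.trans (hM k (by omega))) _)
    rw [← lintegral_const_mul' _ _ ENNReal.ofReal_ne_top]
    refine lintegral_mono fun y => ?_
    rw [← ENNReal.ofReal_mul (Real.exp_pos _).le, ← Real.exp_add, ← mul_add]
    refine ENNReal.ofReal_le_ofReal (Real.exp_le_exp.2 (mul_le_mul_of_nonneg_left ?_ hl))
    obtain ⟨z, hz, hzZ, hyz⟩ := hg y
    refine (distToOrthogonal_sq_le (snoc_mem_scaledOrthonormalFamilies hZ hz hzZ) _).trans ?_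
    rw [hYZ, Fin.sum_univ_castSucc]
    simpa [MeasurableEquiv.piFinSuccAbove, Fin.insertNthEquiv] using hyz

/-- Row `j` contributes at most `exp (1/4 + j/2)`, and these exponents sum to exactly `k² / 4` over
`j < k`. -/
theorem lintegral_exp_distToOrthogonal_sq_div_four_le {k d : ℕ} (hkd : 4 * k < d) :
    ∫⁻ Y : Fin k → EuclideanSpace ℝ (Fin d),
        ENNReal.ofReal (Real.exp (1 / 4 * distToOrthogonal √d Y ^ 2))
        ∂(Measure.pi fun _ => stdGaussian _) ≤ ENNReal.ofReal (Real.exp ((k : ℝ) ^ 2 / 4)) := by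
  have hd : (0 : ℝ) < d := by exact_mod_cast (by omega : 0 < d)
  refine (lintegral_exp_distToOrthogonal_sq_le (Real.sqrt_pos.2 hd) (by norm_num)
    (fun j => ENNReal.ofReal (Real.exp (1 / 4 + (j : ℝ) / 2))) (by simp; omega)
    fun j hj => ?_).trans ?_
  · rw [lintegral_exp_sq_div_four, finrank_euclideanSpace, Fintype.card_fin]
    refine (mul_le_mul_right (lintegral_exp_norm_sub_sq_div_four_le (by omega)
      (Real.sqrt_pos.2 hd)) _).trans ?_
    rw [← ENNReal.ofReal_pow (Real.sqrt_nonneg _), ← ENNReal.ofReal_mul (by positivity)]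
    apply ENNReal.ofReal_le_ofReal
    -- The norm deviation contributes `j / 16` through `j² / d ≤ j / 4`, so `7 / 16` is what remains
    -- of `j / 2`.
    have h2 : √2 ≤ Real.exp (7 / 16) := by
      rw [Real.sqrt_le_iff]
      refine ⟨(Real.exp_pos _).le, ?_⟩
      rw [← Real.exp_nat_mul, ← Real.log_le_iff_le_exp (by norm_num)]
      linarith [Real.log_two_lt_d9]
    rw [Real.sq_sqrt hd.le, Nat.cast_sub (by omega), sub_sub_cancel]
    have h3 : (j : ℝ) ^ 2 / d ≤ j / 4 := by
      have : 4 * (j : ℝ) ≤ d := by exact_mod_cast (by omega : 4 * j ≤ d)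
      rw [div_le_div_iff₀ hd (by norm_num)]
      nlinarith [Nat.cast_nonneg (α := ℝ) j]
    calc _ ≤ Real.exp (7 / 16) ^ j * Real.exp ((1 + (j : ℝ) / 4) / 4) := by gcongr
      _ = _ := by
        rw [← Real.exp_nat_mul, ← Real.exp_add]
        ring_nf
  · rw [← ENNReal.ofReal_prod_of_nonneg fun _ _ => (Real.exp_pos _).le, ← Real.exp_sum]
    refine ENNReal.ofReal_le_ofReal (Real.exp_le_exp.2 (le_of_eq ?_))
    clear hkd
    induction k with
    | zero => simp
    | succ k ih =>
      rw [Finset.sum_range_succ, ih]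
      push_cast
      ring

/-- A single row has no projection term, so the larger factor `1 / 2` is available; the tail bound
for `k = 1` needs it. -/
theorem lintegral_exp_distToOrthogonal_sq_div_two_le {d : ℕ} (hd : 0 < d) :
    ∫⁻ Y : Fin 1 → EuclideanSpace ℝ (Fin d),
        ENNReal.ofReal (Real.exp (1 / 2 * distToOrthogonal √d Y ^ 2))
        ∂(Measure.pi fun _ => stdGaussian _) ≤ ENNReal.ofReal (Real.exp (1 / 2)) := by
  have hd' : (0 : ℝ) < d := by exact_mod_cast hd
  refine (lintegral_exp_distToOrthogonal_sq_le (Real.sqrt_pos.2 hd') (by norm_num)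
    (fun _ => ENNReal.ofReal (Real.exp (1 / 2))) (by simp; omega) fun j hj => ?_).trans (by simp)
  obtain rfl : j = 0 := by omega
  rw [pow_zero, one_mul, finrank_euclideanSpace, Fintype.card_fin]
  refine (lintegral_exp_norm_sub_sq_le (by omega) (Real.sqrt_pos.2 hd')).trans ?_
  rw [Real.sq_sqrt hd'.le]
  simp

/-! ### Tail bound for the distance. -/

theorem measure_le_of_lintegral_exp_le {α : Type*} [MeasurableSpace α] {ν : Measure α} {f : α → ℝ}
    (hf : Measurable f) {l b c s : ℝ} (hl : 0 ≤ l) (hc : 0 ≤ c)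
    (h : ∫⁻ x, ENNReal.ofReal (Real.exp (l * f x ^ 2)) ∂ν ≤ ENNReal.ofReal (Real.exp b))
    (hs : b + s ≤ l * c ^ 2) :
    ν {x | c ≤ f x} ≤ ENNReal.ofReal (Real.exp (-s)) := by
  have h1 : ν {x | c ≤ f x} ≤
      ν {x | ENNReal.ofReal (Real.exp (l * c ^ 2)) ≤ ENNReal.ofReal (Real.exp (l * f x ^ 2))} := by
    refine measure_mono fun x hx => ENNReal.ofReal_le_ofReal (Real.exp_le_exp.2 ?_)
    have : c ≤ f x := hx
    gcongr
  refine h1.trans ((meas_ge_le_lintegral_div (by fun_prop) (by simp [Real.exp_pos])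
    ENNReal.ofReal_ne_top).trans ((ENNReal.div_le_div_right h _).trans ?_))
  rw [← ENNReal.ofReal_div_of_pos (Real.exp_pos _), ← Real.exp_sub]
  exact ENNReal.ofReal_le_ofReal (Real.exp_le_exp.2 (by linarith))

theorem measure_distToOrthogonal_ge_le {k d : ℕ} (hk : 1 ≤ k) (hkd : 4 * k < d) {t : ℝ}
    (ht : 0 ≤ t) :
    (Measure.pi fun _ => stdGaussian _) {Y : Fin k → EuclideanSpace ℝ (Fin d) |
      √k * (√k + t) ≤ distToOrthogonal √d Y} ≤ ENNReal.ofReal (Real.exp (-(t ^ 2 / 2))) := by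
  have hm := (continuous_distToOrthogonal (E := EuclideanSpace ℝ (Fin d)) (k := k)
    (a := √d)).measurable
  have hk' : (1 : ℝ) ≤ k := by exact_mod_cast hk
  have hsq : (√k * (√k + t)) ^ 2 = k * (k + 2 * √k * t + t ^ 2) := by
    rw [mul_pow, Real.sq_sqrt (by positivity), add_sq, Real.sq_sqrt (by positivity)]
  have hst : 0 ≤ √k * t := by positivity
  -- The factor `1 / 4` yields the term `k t² / 4`, which reaches `t² / 2` only for `k ≥ 2`.
  obtain rfl | hk2 := eq_or_lt_of_le hk
  · refine measure_le_of_lintegral_exp_le hm (by norm_num) (by positivity)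
      (lintegral_exp_distToOrthogonal_sq_div_two_le (by omega)) ?_
    rw [hsq]
    push_cast
    push_cast at hst
    linarith
  · have hk3 : (2 : ℝ) ≤ k := by exact_mod_cast hk2
    refine measure_le_of_lintegral_exp_le hm (by norm_num) (by positivity)
      (lintegral_exp_distToOrthogonal_sq_div_four_le hkd) ?_
    rw [hsq]
    nlinarith [mul_nonneg (sub_nonneg.2 hk3) (sq_nonneg t),
      mul_nonneg (by linarith : (0 : ℝ) ≤ k) hst]

/-! ### Law of the compressed Gaussian matrix. -/

namespace IsGaussianMatrix

variable {Ω : Type*} [MeasurableSpace Ω] {μ : Measure Ω} {n k d : ℕ}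
  {R : Ω → Matrix (Fin n) (Fin d) ℝ}

theorem memLp_two (hR : IsGaussianMatrix μ R) (i : Fin n) (j : Fin d) :
    MemLp (fun ω => R ω i j) 2 μ :=
  (hR.law i j).hasGaussianLaw.memLp_two

theorem covariance_eq (hR : IsGaussianMatrix μ R) (i i' : Fin n) (j j' : Fin d) :
    cov[fun ω => R ω i j, fun ω => R ω i' j'; μ] = if i = i' ∧ j = j' then 1 / (d : ℝ) else 0 := by
  split_ifs with h
  · obtain ⟨rfl, rfl⟩ := h
    rw [covariance_self (hR.law i j).aemeasurable, (hR.law i j).variance_eq,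
      variance_id_gaussianReal]
    simp
  · exact (hR.indep.indepFun (i := (i, j)) (j := (i', j'))
      (by simpa [Prod.ext_iff] using h)).covariance_eq_zero (hR.memLp_two i j) (hR.memLp_two i' j')

theorem covariance_mul_eq (hR : IsGaussianMatrix μ R) (hd : 0 < d) {V : Matrix (Fin n) (Fin k) ℝ}
    (hV : Vᵀ * V = 1) (i i' : Fin k) (j j' : Fin d) :
    cov[fun ω => √d * (Vᵀ * R ω) i j, fun ω => √d * (Vᵀ * R ω) i' j'; μ] =
      if i = i' ∧ j = j' then 1 else 0 := by
  have := hR.indep.isProbabilityMeasure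
  have hd' : (0 : ℝ) < d := by exact_mod_cast hd
  simp only [Matrix.mul_apply]
  rw [covariance_const_mul_left, covariance_const_mul_right, covariance_fun_sum_fun_sum
    (fun l => (hR.memLp_two l j).const_mul _) (fun l => (hR.memLp_two l j').const_mul _)]
  simp only [covariance_const_mul_left, covariance_const_mul_right, hR.covariance_eq]
  have h : ∑ l, V l i' * V l i = if i = i' then 1 else 0 := by
    simp only [eq_comm (a := i), ← Matrix.one_apply, ← hV, Matrix.mul_apply, Matrix.transpose_apply]
  by_cases hj : j = j'
  · simp only [hj, and_true, mul_ite, mul_zero, Finset.sum_ite_eq, Finset.mem_univ, if_true,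
      Matrix.transpose_apply]
    simp only [← mul_assoc, ← Finset.sum_mul]
    rw [h, Real.mul_self_sqrt hd'.le]
    split_ifs
    · field_simp
    · simp
  · simp [hj]

theorem hasGaussianLaw_mul (hR : IsGaussianMatrix μ R) (V : Matrix (Fin n) (Fin k) ℝ) :
    HasGaussianLaw (fun ω i j => √d * (Vᵀ * R ω) i j) μ := by
  have h0 : HasGaussianLaw (fun ω (p : Fin n × Fin d) => R ω p.1 p.2) μ :=
    hR.indep.hasGaussianLaw fun p => (hR.law p.1 p.2).hasGaussianLaw
  let L : (Fin n × Fin d → ℝ) →L[ℝ] (Fin k → Fin d → ℝ) :=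
    ContinuousLinearMap.pi fun i => ContinuousLinearMap.pi fun j =>
      √d • ∑ l, V l i • ContinuousLinearMap.proj (R := ℝ) (φ := fun _ : Fin n × Fin d => ℝ) (l, j)
  have h1 := h0.map_fun L
  have hL : (fun ω i j => √d * (Vᵀ * R ω) i j) = fun ω => L fun p => R ω p.1 p.2 := by
    ext ω i j
    simp [L, Matrix.mul_apply]
  rwa [hL]

/-- The rows of `Vᵀ R`, rescaled, are independent standard Gaussian vectors, for a matrix `V` with
orthonormal columns. -/
theorem map_mul_eq (hR : IsGaussianMatrix μ R) (hd : 0 < d) {V : Matrix (Fin n) (Fin k) ℝ}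
    (hV : Vᵀ * V = 1) :
    μ.map (fun ω i => WithLp.toLp 2 fun j => √d * (Vᵀ * R ω) i j) =
      Measure.pi fun _ : Fin k => stdGaussian (EuclideanSpace ℝ (Fin d)) := by
  have := hR.indep.isProbabilityMeasure
  have hX := hR.hasGaussianLaw_mul V
  -- The entries are jointly Gaussian, so vanishing covariances give independence, here between rows
  -- and below within a row.
  have hrow : iIndepFun (fun i ω j => √d * (Vᵀ * R ω) i j) μ :=
    hX.iIndepFun_of_covariance_eval (X := fun i j ω => √d * (Vᵀ * R ω) i j)
      fun i i' hi j j' => by rw [hR.covariance_mul_eq hd hV, if_neg fun h => hi h.1]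
  have hrow' := hrow.comp (fun _ x => WithLp.toLp 2 x) fun _ => by fun_prop
  have hm : ∀ i, AEMeasurable (fun ω j => √d * (Vᵀ * R ω) i j) μ := fun i =>
    (hX.eval i).aemeasurable
  refine (hrow'.map_fun_eq_pi_map fun i => ?_).trans ?_
  · exact AEMeasurable.comp_aemeasurable (by fun_prop) (hm i)
  congr with i : 1
  have hcol : iIndepFun (fun j ω => √d * (Vᵀ * R ω) i j) μ :=
    (hX.eval i).iIndepFun_of_covariance_eq_zero fun j j' hj => by
      rw [hR.covariance_mul_eq hd hV, if_neg fun h => hj h.2]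
  rw [← map_pi_eq_stdGaussian, ← AEMeasurable.map_map_of_aemeasurable (by fun_prop) (hm i),
    hcol.map_fun_eq_pi_map fun j => ((hX.eval i).eval j).aemeasurable]
  congr with j : 2
  rw [((hX.eval i).eval j).map_eq_gaussianReal, ← covariance_self
    ((hX.eval i).eval j).aemeasurable, hR.covariance_mul_eq hd hV]
  have h0 : ∀ l, ∫ ω, R ω l j ∂μ = 0 := fun l => by
    rw [(hR.law l j).integral_eq]
    simp
  have : ∫ ω, √d * (Vᵀ * R ω) i j ∂μ = 0 := by
    simp only [Matrix.mul_apply]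
    rw [integral_const_mul, integral_finsetSum _ fun l _ =>
      ((hR.memLp_two l j).integrable one_le_two).const_mul _]
    simp [integral_const_mul, h0]
  rw [this]
  simp

end IsGaussianMatrix

/-! ### Frobenius norms and stability of the `k`-means cost. -/

theorem frobenius_norm_sq_eq_sum {l m : ℕ} (A : Matrix (Fin l) (Fin m) ℝ) :
    ‖A‖ ^ 2 = ∑ i, ∑ j, A i j ^ 2 := by
  rw [Matrix.frobenius_norm_def, ← Real.sqrt_eq_rpow, Real.sq_sqrt (by positivity)]
  simp

theorem frobenius_norm_sq_eq_trace {l m : ℕ} (A : Matrix (Fin l) (Fin m) ℝ) :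
    ‖A‖ ^ 2 = (Aᵀ * A).trace := by
  rw [frobenius_norm_sq_eq_sum, Finset.sum_comm]
  simp [Matrix.trace, Matrix.mul_apply, sq]

theorem frobenius_norm_mul_of_transpose_mul_self {l m p : ℕ} {V : Matrix (Fin l) (Fin m) ℝ}
    (hV : Vᵀ * V = 1) (A : Matrix (Fin m) (Fin p) ℝ) : ‖V * A‖ = ‖A‖ := by
  rw [← sq_eq_sq₀ (norm_nonneg _) (norm_nonneg _), frobenius_norm_sq_eq_trace,
    frobenius_norm_sq_eq_trace, Matrix.transpose_mul, Matrix.mul_assoc, ← Matrix.mul_assoc Vᵀ, hV,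
    Matrix.one_mul]

theorem frobenius_norm_mul_of_mul_transpose_self {l m p : ℕ} {V : Matrix (Fin m) (Fin p) ℝ}
    (hV : V * Vᵀ = 1) (A : Matrix (Fin l) (Fin m) ℝ) : ‖A * V‖ = ‖A‖ := by
  rw [← Matrix.frobenius_norm_transpose, Matrix.transpose_mul,
    frobenius_norm_mul_of_transpose_mul_self (by simpa using hV), Matrix.frobenius_norm_transpose]

/-- `Xᵀ X` is diagonal, with entry `1` at nonempty clusters and `0` at empty ones, whose columns of
`X` vanish. Thus `X Xᵀ` is idempotent even when `Xᵀ X ≠ 1`. -/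
theorem indicatorMatrix_mul_transpose_mul_self {n k : ℕ} (c : Fin n → Fin k) :
    indicatorMatrix c * (indicatorMatrix c)ᵀ * indicatorMatrix c = indicatorMatrix c := by
  have h : (indicatorMatrix c)ᵀ * indicatorMatrix c = Matrix.diagonal fun j =>
      ((Finset.univ.filter fun l => c l = j).card : ℝ) *
        (1 / √((Finset.univ.filter fun l => c l = j).card : ℝ)) ^ 2 := by
    ext m j
    rw [Matrix.mul_apply, Matrix.diagonal_apply]
    simp only [Matrix.transpose_apply, indicatorMatrix, Matrix.of_apply]
    split_ifs with hmj
    · subst hmj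
      rw [← nsmul_eq_mul, ← Finset.sum_const, Finset.sum_filter]
      refine Finset.sum_congr rfl fun l _ => ?_
      split_ifs <;> ring
    · refine Finset.sum_eq_zero fun l _ => ?_
      by_cases hl : c l = m
      · rw [if_neg (fun h => hmj (hl.symm.trans h)), mul_zero]
      · rw [if_neg hl, zero_mul]
  rw [Matrix.mul_assoc, h]
  ext i j
  rw [Matrix.mul_diagonal]
  simp only [indicatorMatrix, Matrix.of_apply]
  split_ifs with hij
  · have hpos : (0 : ℝ) < (Finset.univ.filter fun l => c l = j).card := by
      exact_mod_cast Finset.card_pos.2 ⟨i, by simpa using hij⟩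
    rw [div_pow, Real.sq_sqrt hpos.le]
    field_simp
  · simp

/-- Pythagoras for the orthogonal projection `X Xᵀ`. -/
theorem kMeansCost_le_norm {n m k : ℕ} {X : Matrix (Fin n) (Fin k) ℝ}
    (hX : X ∈ indicatorMatrices n k) (F : Matrix (Fin n) (Fin m) ℝ) : kMeansCost F X ≤ ‖F‖ := by
  obtain ⟨c, rfl⟩ := hX
  set P := indicatorMatrix c * (indicatorMatrix c)ᵀ with hP
  have hPt : Pᵀ = P := by simp [hP]
  have hPP : P * P = P := by
    rw [hP, ← Matrix.mul_assoc, indicatorMatrix_mul_transpose_mul_self]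
  have h : ‖F - P * F‖ ^ 2 = ‖F‖ ^ 2 - ‖P * F‖ ^ 2 := by
    simp only [frobenius_norm_sq_eq_trace, ← Matrix.trace_sub]
    congr 1
    have h1 : Fᵀ * P * (P * F) = Fᵀ * P * F := by
      rw [Matrix.mul_assoc, ← Matrix.mul_assoc P P, hPP, ← Matrix.mul_assoc]
    rw [Matrix.transpose_sub, Matrix.transpose_mul, hPt, Matrix.sub_mul, Matrix.mul_sub,
      Matrix.mul_sub, h1, ← Matrix.mul_assoc Fᵀ P F]
    abel
  refine (abs_le_of_sq_le_sq' ?_ (norm_nonneg _)).2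
  rw [kMeansCost, ← hP, h]
  linarith [sq_nonneg ‖P * F‖]

theorem kMeansCost_mul_le_add {n m d k : ℕ} {Φ : Matrix (Fin n) (Fin m) ℝ} (hΦ : Φᵀ * Φ = 1)
    (A B : Matrix (Fin m) (Fin d) ℝ) {X : Matrix (Fin n) (Fin k) ℝ}
    (hX : X ∈ indicatorMatrices n k) :
    kMeansCost (Φ * A) X ≤ kMeansCost (Φ * B) X + ‖A - B‖ := by
  have h1 := kMeansCost_le_norm hX (Φ * (A - B))
  rw [frobenius_norm_mul_of_transpose_mul_self hΦ] at h1
  have h2 : Φ * A - X * Xᵀ * (Φ * A) =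
      (Φ * B - X * Xᵀ * (Φ * B)) + (Φ * (A - B) - X * Xᵀ * (Φ * (A - B))) := by
    simp only [Matrix.mul_sub]
    abel
  calc kMeansCost (Φ * A) X ≤ kMeansCost (Φ * B) X + kMeansCost (Φ * (A - B)) X := by
        simp only [kMeansCost]
        rw [h2]
        exact norm_add_le _ _
    _ ≤ _ := by gcongr

theorem kMeansCost_mul_of_mul_transpose_self {n m d k : ℕ} (Φ : Matrix (Fin n) (Fin m) ℝ)
    {V : Matrix (Fin m) (Fin d) ℝ} (hV : V * Vᵀ = 1) (X : Matrix (Fin n) (Fin k) ℝ) :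
    kMeansCost (Φ * V) X = kMeansCost Φ X := by
  rw [kMeansCost, kMeansCost, ← frobenius_norm_mul_of_mul_transpose_self hV (Φ - _),
    Matrix.sub_mul, Matrix.mul_assoc _ Φ V]

/-- If the features `Φ B` are close to an isometric copy `Φ V` of `Φ`, then an optimal assignment
for `Φ B` is nearly optimal for `Φ`. -/
theorem kMeansCost_le_add_of_isKMeansAssignment {n m d k : ℕ} {Φ : Matrix (Fin n) (Fin m) ℝ}
    (hΦ : Φᵀ * Φ = 1) {V : Matrix (Fin m) (Fin d) ℝ} (hV : V * Vᵀ = 1)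
    (B : Matrix (Fin m) (Fin d) ℝ) {X Y : Matrix (Fin n) (Fin k) ℝ}
    (hX : IsKMeansAssignment (Φ * B) X) (hY : Y ∈ indicatorMatrices n k) :
    kMeansCost Φ X ≤ kMeansCost Φ Y + 2 * ‖V - B‖ := by
  have h1 := kMeansCost_mul_le_add hΦ V B hX.1
  have h2 := kMeansCost_mul_le_add hΦ B V hY
  rw [kMeansCost_mul_of_mul_transpose_self Φ hV] at h1 h2
  rw [norm_sub_rev] at h2
  linarith [hX.2 Y hY]

/-! ### Spectral features, the nearest isometry, and the conclusion. -/

theorem spectralFeatures_transpose_mul_self {n k : ℕ} (hkn : k ≤ n) {U : Matrix (Fin n) (Fin n) ℝ}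
    (hU : U ∈ Matrix.orthogonalGroup (Fin n) ℝ) :
    (spectralFeatures hkn U)ᵀ * spectralFeatures hkn U = 1 := by
  have h := (Matrix.mem_orthogonalGroup_iff' (Fin n) ℝ).1 hU
  ext i j
  have := congrFun (congrFun h (Fin.castLE hkn i)) (Fin.castLE hkn j)
  rw [Matrix.mul_apply, Matrix.one_apply] at this
  rw [Matrix.mul_apply, Matrix.one_apply]
  simpa [spectralFeatures, Matrix.star_apply, (Fin.castLE_injective hkn).eq_iff] using this

theorem lowPassFilter_eq {n k : ℕ} (hkn : k ≤ n) (U : Matrix (Fin n) (Fin n) ℝ) :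
    lowPassFilter k U = spectralFeatures hkn U * (spectralFeatures hkn U)ᵀ := by
  obtain ⟨m, rfl⟩ := Nat.exists_eq_add_of_le hkn
  ext i j
  rw [lowPassFilter, Matrix.mul_apply, Matrix.mul_apply, Fin.sum_univ_add]
  simp [spectralFeatures, Matrix.mul_diagonal, Fin.castAdd]

theorem frobenius_norm_spectralFeatures {n k : ℕ} (hkn : k ≤ n) {U : Matrix (Fin n) (Fin n) ℝ}
    (hU : U ∈ Matrix.orthogonalGroup (Fin n) ℝ) : ‖spectralFeatures hkn U‖ = √k := by
  rw [← Real.sqrt_sq (norm_nonneg _), frobenius_norm_sq_eq_trace,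
    spectralFeatures_transpose_mul_self hkn hU, Matrix.trace_one, Fintype.card_fin]

/-- `V` is the orthogonal family of length `√d` nearest to the rows of `√d B`, divided by `√d`. -/
theorem exists_mul_transpose_self_eq_one_and_norm_sub {k d : ℕ} (hkd : k ≤ d) (hd : 0 < d)
    (B : Matrix (Fin k) (Fin d) ℝ) :
    ∃ V : Matrix (Fin k) (Fin d) ℝ, V * Vᵀ = 1 ∧
      ‖V - B‖ = distToOrthogonal √d
        (fun i => (WithLp.toLp 2 fun j => √d * B i j : EuclideanSpace ℝ (Fin d))) / √d := by
  have hd' : (0 : ℝ) < d := by exact_mod_cast hd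
  have hs : 0 < √(d : ℝ) := Real.sqrt_pos.2 hd'
  obtain ⟨Z, hZ, hZB⟩ := exists_distToOrthogonal_sq_eq (Real.sqrt_nonneg d) (by simpa using hkd)
    (fun i => (WithLp.toLp 2 fun j => √d * B i j : EuclideanSpace ℝ (Fin d)))
  refine ⟨Matrix.of fun i j => Z i j / √d, ?_, ?_⟩
  · ext i l
    have := hZ i l
    rw [PiLp.inner_apply, Real.sq_sqrt hd'.le] at this
    rw [Matrix.mul_apply, Matrix.one_apply]
    simp only [Matrix.of_apply, Matrix.transpose_apply, div_mul_div_comm, ← Finset.sum_div,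
      Real.mul_self_sqrt hd'.le]
    rw [div_eq_iff hd'.ne', ite_mul, one_mul, zero_mul, ← this]
    simp [mul_comm]
  · rw [← sq_eq_sq₀ (norm_nonneg _) (div_nonneg (distToOrthogonal_nonneg _) hs.le), div_pow, hZB,
      frobenius_norm_sq_eq_sum, Real.sq_sqrt hd'.le, Finset.sum_div]
    refine Finset.sum_congr rfl fun i _ => ?_
    rw [EuclideanSpace.real_norm_sq_eq, Finset.sum_div]
    refine Finset.sum_congr rfl fun j _ => ?_
    simp only [Matrix.sub_apply, Matrix.of_apply, PiLp.sub_apply]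
    rw [eq_div_iff hd'.ne']
    nth_rewrite 2 [← Real.sq_sqrt hd'.le]
    rw [← mul_pow, sub_mul, div_mul_cancel₀ _ hs.ne']
    ring

theorem mainTheorem1 {Ω : Type*} [MeasurableSpace Ω] (μ : Measure Ω) [IsProbabilityMeasure μ]
    {n k d : ℕ} (hk : 1 ≤ k) (hkn : k ≤ n) (hd : 1 ≤ d)
    (G : WeightedGraph n) (L : Matrix (Fin n) (Fin n) ℝ)
    (hL : L = G.combinatorialLaplacian ∨ L = G.normalizedLaplacian)
    (U : Matrix (Fin n) (Fin n) ℝ) (lam : Fin n → ℝ) (hU : IsEigendecomposition L U lam)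
    (R : Ω → Matrix (Fin n) (Fin d) ℝ) (hR : IsGaussianMatrix μ R)
    (XΦ : Matrix (Fin n) (Fin k) ℝ) (hXΦ : IsKMeansAssignment (spectralFeatures hkn U) XΦ)
    (t : ℝ) (ht : 0 ≤ t) :
    1 - Real.exp (-t ^ 2 / 2) ≤
      μ.real {ω | ∀ XΨ : Matrix (Fin n) (Fin k) ℝ,
        IsKMeansAssignment (lowPassFilter k U * R ω) XΨ →
          kMeansCost (spectralFeatures hkn U) XΦ ≤ kMeansCost (spectralFeatures hkn U) XΨ ∧
          kMeansCost (spectralFeatures hkn U) XΨ ≤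
            kMeansCost (spectralFeatures hkn U) XΦ
              + 2 * Real.sqrt ((k : ℝ) / (d : ℝ)) * (Real.sqrt (k : ℝ) + t)} := by
  have hd0 : 0 < d := hd
  have hd' : (0 : ℝ) < d := by exact_mod_cast hd0
  have hΦ := spectralFeatures_transpose_mul_self hkn hU.orthogonal
  set Φ := spectralFeatures hkn U with hΦdef
  -- If `d ≤ 4 k`, then `2 √(k/d) ≥ 1`, and the bound holds surely because no cost exceeds `‖Φ‖ =
  -- √k`.
  by_cases hkd : 4 * k < d
  · have hlow : ∀ ω, lowPassFilter k U * R ω = Φ * (Φᵀ * R ω) := fun ω => by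
      rw [lowPassFilter_eq hkn, Matrix.mul_assoc]
    let Y : Ω → Fin k → EuclideanSpace ℝ (Fin d) := fun ω i =>
      WithLp.toLp 2 fun j => √d * (Φᵀ * R ω) i j
    have hY : AEMeasurable Y μ :=
      aemeasurable_pi_lambda _ fun i => Measurable.comp_aemeasurable (by fun_prop)
        ((hR.hasGaussianLaw_mul Φ).eval i).aemeasurable
    set bad : Set (Fin k → EuclideanSpace ℝ (Fin d)) :=
      {y | √k * (√k + t) ≤ distToOrthogonal √d y} with hbad
    have hbadm : MeasurableSet bad :=
      measurableSet_le measurable_const continuous_distToOrthogonal.measurable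
    have h1 : μ (Y ⁻¹' bad) ≤ ENNReal.ofReal (Real.exp (-(t ^ 2 / 2))) := by
      rw [← Measure.map_apply_of_aemeasurable hY hbadm, hR.map_mul_eq hd0 hΦ]
      exact measure_distToOrthogonal_ge_le hk hkd ht
    have h2 : μ.real (Y ⁻¹' bad) ≤ Real.exp (-t ^ 2 / 2) := by
      rw [neg_div]
      exact ENNReal.toReal_le_of_le_ofReal (Real.exp_pos _).le h1
    -- Subadditivity and monotonicity suffice, so measurability of the success event is not
    -- required.
    have h3 := measureReal_union_le (μ := μ) (Y ⁻¹' bad)ᶜ (Y ⁻¹' bad)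
    rw [Set.compl_union_self, probReal_univ] at h3
    refine (by linarith : 1 - Real.exp (-t ^ 2 / 2) ≤ μ.real (Y ⁻¹' bad)ᶜ).trans
      (measureReal_mono fun ω hω XΨ hXΨ => ⟨hXΦ.2 _ hXΨ.1, ?_⟩)
    rw [hlow] at hXΨ
    obtain ⟨V, hV, hVB⟩ := exists_mul_transpose_self_eq_one_and_norm_sub (by omega) hd0 (Φᵀ * R ω)
    refine (kMeansCost_le_add_of_isKMeansAssignment hΦ hV _ hXΨ hXΦ.1).trans ?_
    have h4 : distToOrthogonal √d (Y ω) ≤ √k * (√k + t) :=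
      (lt_of_not_ge fun h : √k * (√k + t) ≤ distToOrthogonal √d (Y ω) => hω h).le
    rw [hVB, Real.sqrt_div' _ hd'.le, mul_assoc, div_mul_eq_mul_div]
    gcongr
  · have huniv : {ω | ∀ XΨ : Matrix (Fin n) (Fin k) ℝ,
        IsKMeansAssignment (lowPassFilter k U * R ω) XΨ →
          kMeansCost Φ XΦ ≤ kMeansCost Φ XΨ ∧
          kMeansCost Φ XΨ ≤ kMeansCost Φ XΦ
            + 2 * Real.sqrt ((k : ℝ) / (d : ℝ)) * (Real.sqrt (k : ℝ) + t)} = Set.univ := by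
      refine Set.eq_univ_of_forall fun ω XΨ hXΨ => ⟨hXΦ.2 _ hXΨ.1, ?_⟩
      have h1 := kMeansCost_le_norm hXΨ.1 Φ
      rw [frobenius_norm_spectralFeatures hkn hU.orthogonal] at h1
      have h2 : 0 ≤ kMeansCost Φ XΦ := norm_nonneg _
      have h3 : 1 / 2 ≤ √((k : ℝ) / d) := by
        have : (d : ℝ) ≤ 4 * k := by exact_mod_cast not_lt.1 hkd
        refine Real.le_sqrt_of_sq_le ?_
        rw [le_div_iff₀ hd']
        linarith
      nlinarith [mul_le_mul_of_nonneg_right h3 (add_nonneg (Real.sqrt_nonneg (k : ℝ)) ht)]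
    rw [huniv, probReal_univ]
    linarith [Real.exp_pos (-t ^ 2 / 2)]
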